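/- All graphs are finite, simple and have at least one vertex. For a graph $G=(V,E)$, a set $S\subseteq V$ is a \emph{power dominating set} if, starting with exactly the vertices of $S$ colored, all vertices become colored after (1) every neighbor of a vertex of $S$ is colored (once), and then (2) the following rule is applied as long as possible: whenever a colored vertex has exactly one uncolored neighbor, that neighbor becomes colored. Let $p(G;i)$ be the number of power dominating sets of $G$ of cardinality $i$, let $\mathcal{P}(G;x)=\sum_{i=1}^{|V|}p(G;i)\,x^i$, and call the complex roots of $\mathcal{P}(G;x)$ the \emph{power domination roots} of $G$. Let $\mathscr{F}$ be the family of all graphs obtained from a connected graph $H$ by adding, for each vertex $v$ of $H$, two new vertices $v'$ and $v''$, the two new edges $vv'$ and $vv''$, and possibly (independently for each $v$) the edge $v'v''$. \textbf{Theorem.} A graph $G$ has exactly three distinct power domination roots if and only if $G\simeq G_1\,\dot\cup\,\cdots\,\dot\cup\,G_k\,\dot\cup\,\overline{K_r}$ (disjoint union) for some $k\ge 1$, $r\ge 0$ and $G_1,\dots,G_k\in\mathscr{F}$, where $\overline{K_r}$ denotes the graph with $r$ vertices and no edges. Moreover, if $G$ has exactly three distinct power domination roots, these roots are $0$, $\frac{-3+\sqrt3\,i}{2}$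 and $\frac{-3-\sqrt3\,i}{2}$. -/

import Mathlib

open Polynomial

/-- `PowerColored G S v`: the vertex `v` becomes colored when `S` is the set of initially colored
vertices, after one domination step and then as many forcing steps as possible.  (In the rule
`force`, the vertex `v` is colored and `w` is its only neighbor that is possibly uncolored.) -/
inductive PowerColored {V : Type*} (G : SimpleGraph V) (S : Set V) : V → Prop
  | initial {v : V} : v ∈ S → PowerColored G S v
  | dominate {v w : V} : v ∈ S → G.Adj v w → PowerColored G S w
  | force {v w : V} : PowerColored G S v → G.Adj v w →
      (∀ u : V, G.Adj v u → u ≠ w → PowerColored G S u) → PowerColored G S w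

/-- `S` is a power dominating set of `G`. -/
def IsPowerDominating {V : Type*} (G : SimpleGraph V) (S : Set V) : Prop :=
  ∀ v : V, PowerColored G S v

/-- The number `p(G; i)` of power dominating sets of `G` of cardinality `i`. -/
noncomputable def powerDomCount {V : Type*} (G : SimpleGraph V) (i : ℕ) : ℕ :=
  {S : Finset V | S.card = i ∧ IsPowerDominating G (S : Set V)}.ncard

/-- The power domination polynomial `∑_{i=1}^n p(G; i) x^i`. -/
noncomputable def powerDomPoly {V : Type*} [Fintype V] (G : SimpleGraph V) : ℤ[X] :=
  ∑ i ∈ Finset.Icc 1 (Fintype.card V), C (powerDomCount G i : ℤ) * X ^ i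

/-- The set of distinct power domination roots of `G`, i.e. of complex roots of its power
domination polynomial. -/
def powerDomRoots {V : Type*} [Fintype V] (G : SimpleGraph V) : Set ℂ :=
  {z : ℂ | aeval z (powerDomPoly G) = 0}

/-- The graph obtained from `H` by adding, for each vertex `v = (v, 0)`, two new vertices
`v' = (v, 1)` and `v'' = (v, 2)`, the edges `vv'` and `vv''`, and, if `v ∈ T`, also the
edge `v'v''`. -/
def attachPendants {W : Type*} (H : SimpleGraph W) (T : Set W) : SimpleGraph (W × Fin 3) where
  Adj x y :=
    (x.2 = 0 ∧ y.2 = 0 ∧ H.Adj x.1 y.1) ∨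
      (x.1 = y.1 ∧ x.2 ≠ y.2 ∧ (x.2 = 0 ∨ y.2 = 0 ∨ x.1 ∈ T))
  symm := ⟨by
    rintro ⟨a, i⟩ ⟨b, j⟩ (⟨h1, h2, h3⟩ | ⟨h1, h2, h3⟩)
    · exact Or.inl ⟨h2, h1, h3.symm⟩
    · refine Or.inr ⟨h1.symm, h2.symm, ?_⟩
      rcases h3 with h | h | h
      · exact Or.inr (Or.inl h)
      · exact Or.inl h
      · exact Or.inr (Or.inr ((show a = b from h1) ▸ h))⟩
  loopless := ⟨by
    rintro ⟨a, i⟩ (⟨_, _, h⟩ | ⟨_, h, _⟩)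
    · exact H.irrefl h
    · exact h rfl⟩

/-- The family of graphs obtained, up to isomorphism, from a finite connected graph `H` by
adding two new vertices `v'`, `v''`, the edges `vv'`, `vv''`, and possibly the edge `v'v''`,
for each vertex `v` of `H`.  (`SimpleGraph.Connected` includes that `H` has a vertex.) -/
def InFamilyF {V : Type*} (G : SimpleGraph V) : Prop :=
  ∃ (m : ℕ) (H : SimpleGraph (Fin m)) (T : Set (Fin m)),
    H.Connected ∧ Nonempty (G ≃g attachPendants H T)

/-- The disjoint union of an indexed family of graphs. -/
def disjointUnion {ι : Type*} {U : ι → Type*} (G : ∀ i, SimpleGraph (U i)) :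
    SimpleGraph (Σ i, U i) where
  Adj x y := ∃ (i : ι) (u v : U i), x = ⟨i, u⟩ ∧ y = ⟨i, v⟩ ∧ (G i).Adj u v
  symm := ⟨by
    rintro _ _ ⟨i, u, v, rfl, rfl, h⟩
    exact ⟨i, v, u, rfl, rfl, h.symm⟩⟩
  loopless := ⟨by
    rintro _ ⟨i, u, v, rfl, h, huv⟩
    cases h
    exact (G i).irrefl huv⟩

/-! ### Power domination under isomorphism, disjoint union and attachment of triples. -/

section PowerColored

variable {V W : Type*} {G : SimpleGraph V} {H : SimpleGraph W}

/-! The generating polynomial of power dominating sets is multiplicative over disjoint unions. An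
isolated vertex contributes `X`, a component K₂ contributes `X * (X + 2)`, and a graph built on `m`
hubs contributes `(X ^ 3 + 3 * X ^ 2 + 3 * X) ^ m`, because its power dominating sets are those
meeting every triple. This gives the easy direction and the roots.

Conversely, strip the isolated vertices and the K₂ components to get `K` on n vertices. In `K`, a
set of at most two vertices has a power dominating complement (`NoSmallComponent.exists_center`), so
the top coefficients are 1, n, C(n,2). If all roots were integers, these would force every root to
be -1, yet 0 is a root. Hence some root is not an integer, and with three roots in all its minimal
polynomial is quadratic and its two roots are the nonzero ones. So no K₂ was stripped, as -2 is not
a root, and `K` has polynomial `X ^ m * (X ^ 2 + p X + q) ^ k`.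

The top coefficients give n = kp and 2q = p² - p. `NoSmallComponent.exists_two_private` yields a
power dominating set `S` with m ≤ |S| ≤ n/3. Together with n = m + 2k and m ≥ 1 this forces p = q =
3 and |S| = k = n/3. The coefficient of x^(n-3) then counts exactly k bad triples, and
`exists_iso_attachPendants` identifies them with the blocks of `S` and reads off the structure. -/

lemma PowerColored.map_iso (e : G ≃g H) {S : Set V} {v : V} (h : PowerColored G S v) :
    PowerColored H (e '' S) (e v) := by
  induction h with
  | initial h => exact .initial (Set.mem_image_of_mem _ h)
  | dominate h h' => exact .dominate (Set.mem_image_of_mem _ h) (e.map_adj_iff.2 h')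
  | force _ h' _ ih ih' =>
    refine .force ih (e.map_adj_iff.2 h') fun u hu hne => ?_
    obtain ⟨u, rfl⟩ := e.surjective u
    exact ih' u (e.map_adj_iff.1 hu) fun h => hne (h ▸ rfl)

lemma IsPowerDominating.map_iso (e : G ≃g H) {S : Set V} (h : IsPowerDominating G S) :
    IsPowerDominating H (e '' S) := fun w => by
  obtain ⟨v, rfl⟩ := e.surjective w
  exact (h v).map_iso e

lemma isPowerDominating_image_iso (e : G ≃g H) {S : Set V} :
    IsPowerDominating H (e '' S) ↔ IsPowerDominating G S := by
  refine ⟨fun h => ?_, fun h => h.map_iso e⟩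
  have := h.map_iso e.symm
  rwa [← Set.image_comp, show (e.symm ∘ e : V → V) = id from funext fun x => by simp,
    Set.image_id] at this

lemma powerColored_sum_inl {S : Set (V ⊕ W)} {v : V} :
    PowerColored (G ⊕g H) S (.inl v) ↔ PowerColored G (Sum.inl ⁻¹' S) v := by
  constructor
  · intro h
    generalize hx : (Sum.inl v : V ⊕ W) = x at h
    induction h generalizing v with
    | initial h => subst hx; exact .initial h
    | @dominate a w h h' =>
      subst hx
      rcases a with a | a
      · exact .dominate (v := a) h (by simpa using h')
      · simp at h'
    | @force a w _ h' _ ih ih' =>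
      subst hx
      rcases a with a | a
      · refine .force (ih rfl) (by simpa using h') fun u hu hne => ?_
        exact ih' (.inl u) (by simpa using hu) (by simpa using hne) rfl
      · simp at h'
  · intro h
    induction h with
    | initial h => exact .initial h
    | dominate h h' => exact .dominate h (by simpa using h')
    | force _ h' _ ih ih' =>
      refine .force ih (by simpa using h') fun u hu hne => ?_
      rcases u with u | u
      · exact ih' u (by simpa using hu) (by simpa using hne)
      · simp at hu

lemma isPowerDominating_sum {S : Set (V ⊕ W)} :
    IsPowerDominating (G ⊕g H) S ↔
      IsPowerDominating G (Sum.inl ⁻¹' S) ∧ IsPowerDominating H (Sum.inr ⁻¹' S) := by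
  have hr : ∀ w, PowerColored (G ⊕g H) S (.inr w) ↔ PowerColored H (Sum.inr ⁻¹' S) w := by
    intro w
    have h1 : PowerColored (H ⊕g G) (SimpleGraph.Iso.sumComm (G := G) (H := H) '' S) (.inl w) ↔
        PowerColored (G ⊕g H) S (.inr w) := by
      refine ⟨fun h => ?_, fun h => h.map_iso SimpleGraph.Iso.sumComm⟩
      have := h.map_iso SimpleGraph.Iso.sumComm
      rw [← Set.image_comp] at this
      convert this using 1
      · ext x; simp
      · rfl
    rw [← h1, powerColored_sum_inl]
    convert Iff.rfl using 2
    ext x; simp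
  simp only [IsPowerDominating, Sum.forall, powerColored_sum_inl, hr]

lemma isPowerDominating_bot {S : Set V} :
    IsPowerDominating (⊥ : SimpleGraph V) S ↔ S = Set.univ := by
  refine ⟨fun h => Set.eq_univ_of_forall fun v => ?_, fun h v => .initial (h ▸ trivial)⟩
  cases h v with
  | initial h => exact h
  | dominate _ h => simp at h
  | force _ h _ => simp at h

lemma PowerColored.nonempty {S : Set V} {v : V} (h : PowerColored G S v) : S.Nonempty := by
  induction h with
  | initial h => exact ⟨_, h⟩
  | dominate h _ => exact ⟨_, h⟩
  | force _ _ _ ih _ => exact ih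

lemma isPowerDominating_top [Nonempty V] {S : Set V} :
    IsPowerDominating (⊤ : SimpleGraph V) S ↔ S.Nonempty := by
  refine ⟨fun h => (h (Classical.arbitrary V)).nonempty, fun ⟨s, hs⟩ v => ?_⟩
  by_cases h : s = v
  · exact .initial (h ▸ hs)
  · exact .dominate hs h

/-- If `S` misses a triple, only its hub can be colored from outside, and the hub is then stuck with
two uncolored pendants. If `S` meets every triple, all hubs become colored by domination, and each
hub has at most one uncolored neighbor left. -/
lemma isPowerDominating_attachPendants {T : Set W} {S : Set (W × Fin 3)} :
    IsPowerDominating (attachPendants H T) S ↔ ∀ w, ∃ i, (w, i) ∈ S := by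
  constructor
  · intro h w
    by_contra! hw
    have key : ∀ x, PowerColored (attachPendants H T) S x → x.1 = w → x.2 = 0 := by
      intro x hx
      induction hx with
      | @initial v h => rintro rfl; exact absurd h (hw _)
      | @dominate v u h h' =>
        rintro rfl
        rcases h' with ⟨_, h, _⟩ | ⟨h1, _, _⟩
        · exact h
        · exact absurd (show (u.1, v.2) ∈ S by rw [← h1]; exact h) (hw _)
      | @force v u _ h' _ ih ih' =>
        rintro rfl
        rcases h' with ⟨_, h, _⟩ | ⟨h1, h2, _⟩
        · exact h
        · by_contra h0
          have hv := ih h1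
          -- The other pendant `j` of the hub would have to be colored before `u` is forced.
          obtain ⟨j, hj0, hju⟩ : ∃ j : Fin 3, j ≠ 0 ∧ j ≠ u.2 := by
            generalize u.2 = a; revert a; decide
          refine hj0 (ih' (u.1, j) (Or.inr ⟨h1, ?_, Or.inl hv⟩) (fun h => hju ?_) rfl)
          · rw [hv]; exact hj0.symm
          · exact congrArg Prod.snd h
    exact absurd (key (w, 1) (h _) rfl) (by simp)
  · intro h
    have hub : ∀ w, PowerColored (attachPendants H T) S (w, 0) := by
      intro w
      obtain ⟨i, hi⟩ := h w
      by_cases h0 : i = 0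
      · exact .initial (h0 ▸ hi)
      · exact .dominate hi (Or.inr ⟨rfl, h0, Or.inr (Or.inl rfl)⟩)
    rintro ⟨w, j⟩
    by_cases hj : j = 0
    · exact hj ▸ hub w
    obtain ⟨i, hi⟩ := h w
    by_cases hij : i = j
    · exact .initial (hij ▸ hi)
    by_cases h0 : i = 0
    · exact .dominate hi (Or.inr ⟨rfl, hij, Or.inl h0⟩)
    refine .force (hub w) (Or.inr ⟨rfl, Ne.symm hj, Or.inl rfl⟩) ?_
    rintro ⟨u, l⟩ (⟨_, hl, _⟩ | ⟨hu, hl, _⟩) hne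
    · obtain rfl : l = 0 := hl
      exact hub u
    · obtain rfl : w = u := hu
      -- `0`, `i` and `j` are distinct, so they exhaust `Fin 3`.
      have : l = i := by
        have h1 : (0 : Fin 3) ≠ l := hl
        have h2 : l ≠ j := fun h => hne (h ▸ rfl)
        clear hub hne hl hi
        generalize hk : (0 : Fin 3) = k at *
        omega
      exact this ▸ .initial hi

end PowerColored

/-! ### The generating polynomial and its multiplicativity. -/

section GenPoly

open Classical in
/-- The generating polynomial of all power dominating sets, counting the empty set if the graph
has no vertices. -/
noncomputable def powerDomGenPoly {V : Type*} [Fintype V] (G : SimpleGraph V) : ℤ[X] :=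
  ∑ S : Finset V, if IsPowerDominating G (S : Set V) then X ^ S.card else 0

variable {V W : Type*} [Fintype V] [Fintype W] {G : SimpleGraph V} {H : SimpleGraph W}

open Classical in
lemma coeff_powerDomGenPoly (i : ℕ) :
    (powerDomGenPoly G).coeff i =
      (Finset.univ.filter fun S : Finset V =>
        S.card = i ∧ IsPowerDominating G (S : Set V)).card := by
  rw [powerDomGenPoly, finsetSum_coeff, Finset.card_filter, Nat.cast_sum]
  refine Finset.sum_congr rfl fun S _ => ?_
  split_ifs with h1 h2 h2
  · simp [h2.1]
  · have : i ≠ S.card := fun h => h2 ⟨h.symm, h1⟩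
    simp [coeff_X_pow, this]
  · exact absurd h2.2 h1
  · simp

/-- The empty set colors nothing, so on a nonempty graph starting the sum at 1 loses no term. -/
lemma powerDomPoly_eq_genPoly [Nonempty V] (G : SimpleGraph V) :
    powerDomPoly G = powerDomGenPoly G := by
  classical
  ext i
  rw [coeff_powerDomGenPoly, powerDomPoly, finsetSum_coeff]
  simp only [coeff_C_mul, coeff_X_pow, mul_ite, mul_one, mul_zero, Finset.sum_ite_eq,
    Finset.mem_Icc]
  have hc : powerDomCount G i = (Finset.univ.filter fun S : Finset V =>
        S.card = i ∧ IsPowerDominating G (S : Set V)).card := by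
    rw [powerDomCount, ← Set.ncard_coe_finset]
    congr 1
    ext; simp
  split_ifs with h
  · rw [hc]
  · symm
    rw [Nat.cast_eq_zero, Finset.card_eq_zero, Finset.filter_eq_empty_iff]
    rintro S - ⟨rfl, hS⟩
    refine h ⟨?_, S.card_le_univ⟩
    have := (hS (Classical.arbitrary V)).nonempty
    exact Finset.card_pos.2 (by simpa using this)

lemma powerDomGenPoly_congr (e : G ≃g H) : powerDomGenPoly G = powerDomGenPoly H := by
  classical
  refine Fintype.sum_equiv e.toEquiv.finsetCongr _ _ fun S => ?_
  have : ((e.toEquiv.finsetCongr S : Finset W) : Set W) = e '' (S : Set V) := by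
    ext; simp
  rw [this, isPowerDominating_image_iso]
  simp

lemma powerDomGenPoly_sum (G : SimpleGraph V) (H : SimpleGraph W) :
    powerDomGenPoly (G ⊕g H) = powerDomGenPoly G * powerDomGenPoly H := by
  classical
  rw [powerDomGenPoly, powerDomGenPoly, powerDomGenPoly, Finset.sum_mul_sum,
    ← Fintype.sum_prod_type']
  refine Fintype.sum_equiv Finset.sumEquiv.toEquiv _ _ fun S => ?_
  have h1 : ((S.toLeft : Finset V) : Set V) = Sum.inl ⁻¹' (S : Set (V ⊕ W)) := by ext; simp
  have h2 : ((S.toRight : Finset W) : Set W) = Sum.inr ⁻¹' (S : Set (V ⊕ W)) := by ext; simp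
  simp only [isPowerDominating_sum, ← h1, ← h2, ← Finset.card_toLeft_add_card_toRight (u := S)]
  show _ = (if IsPowerDominating G (S.toLeft : Set V) then (X : ℤ[X]) ^ S.toLeft.card else 0) *
    (if IsPowerDominating H (S.toRight : Set W) then X ^ S.toRight.card else 0)
  split_ifs <;> simp_all [pow_add]

lemma powerDomGenPoly_bot : powerDomGenPoly (⊥ : SimpleGraph V) = X ^ Fintype.card V := by
  classical
  rw [powerDomGenPoly, Finset.sum_eq_single Finset.univ]
  · simp [isPowerDominating_bot]
  · intro S _ hS
    rw [if_neg]
    rw [isPowerDominating_bot]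
    simpa using hS
  · simp

lemma powerDomGenPoly_top_two :
    powerDomGenPoly (⊤ : SimpleGraph (Fin 2)) = X * (X + 2) := by
  classical
  simp only [powerDomGenPoly, isPowerDominating_top, Finset.coe_nonempty]
  rw [show (Finset.univ : Finset (Finset (Fin 2))) = {∅, {0}, {1}, {0, 1}} by decide]
  rw [Finset.sum_insert (by decide), Finset.sum_insert (by decide), Finset.sum_insert (by decide)]
  simp
  ring

/-- A power dominating set is an independent choice of a nonempty subset of each triple, so the sum
is an expanded product. -/
lemma powerDomGenPoly_attachPendants (H : SimpleGraph W) (T : Set W) :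
    powerDomGenPoly (attachPendants H T) = (X ^ 3 + 3 * X ^ 2 + 3 * X) ^ Fintype.card W := by
  classical
  have h3 : ∑ A : Finset (Fin 3), (if A.Nonempty then (X : ℤ[X]) ^ A.card else 0) =
      X ^ 3 + 3 * X ^ 2 + 3 * X := by
    rw [show (Finset.univ : Finset (Finset (Fin 3))) =
      {∅, {0}, {1}, {2}, {0, 1}, {0, 2}, {1, 2}, {0, 1, 2}} by decide]
    iterate 7 rw [Finset.sum_insert (by decide)]
    simp
    ring
  rw [← h3, ← Finset.card_univ, ← Finset.prod_const, Finset.prod_univ_sum,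
    Fintype.piFinset_univ, powerDomGenPoly]
  let e : Finset (W × Fin 3) ≃ (W → Finset (Fin 3)) :=
    { toFun := fun S w => Finset.univ.filter fun i => (w, i) ∈ S
      invFun := fun A => Finset.univ.filter fun p => p.2 ∈ A p.1
      left_inv := fun S => by ext; simp
      right_inv := fun A => by ext; simp }
  refine Fintype.sum_equiv e _ _ fun S => ?_
  have hcard : S.card = ∑ w, (e S w).card := by
    simp only [e, Equiv.coe_fn_mk, Finset.card_filter]
    rw [← Fintype.sum_prod_type' (f := fun w i => if (w, i) ∈ S then 1 else 0)]
    simp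
  have hne : ∀ w, (e S w).Nonempty ↔ ∃ i, (w, i) ∈ S := fun w => by
    simp [e, Finset.Nonempty]
  simp only [isPowerDominating_attachPendants, hne, Finset.mem_coe]
  split_ifs with h
  · rw [Finset.prod_congr rfl fun w _ => if_pos (h w), Finset.prod_pow_eq_pow_sum, hcard]
  · push Not at h
    obtain ⟨w, hw⟩ := h
    exact (Finset.prod_eq_zero (Finset.mem_univ w) (if_neg (by simpa using hw))).symm

end GenPoly

/-! ### Splitting off the components with at most two vertices. -/

section Clean

/-- No connected component of `G` has at most two vertices. -/
def NoSmallComponent {V : Type*} (G : SimpleGraph V) : Prop :=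
  (∀ v, ∃ w, G.Adj v w) ∧
    ∀ v w, G.Adj v w → ∃ u, u ≠ v ∧ u ≠ w ∧ (G.Adj v u ∨ G.Adj w u)

/-- If no edge leaves `A`, the graph is the disjoint union of its restrictions to `A` and `Aᶜ`. -/
noncomputable def isoSumInduceCompl {V : Type*} (G : SimpleGraph V) (A : Set V)
    (hA : ∀ a ∈ A, ∀ b, G.Adj a b → b ∈ A) : G ≃g (G.induce A) ⊕g (G.induce Aᶜ) := by
  classical
  exact
  { toEquiv := (Equiv.Set.sumCompl A).symm
    map_rel_iff' := by
      intro a b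
      obtain ⟨a, rfl⟩ := (Equiv.Set.sumCompl A).surjective a
      obtain ⟨b, rfl⟩ := (Equiv.Set.sumCompl A).surjective b
      simp only [Equiv.symm_apply_apply]
      rcases a with ⟨a, ha⟩ | ⟨a, ha⟩ <;> rcases b with ⟨b, hb⟩ | ⟨b, hb⟩
      · simp
      · simpa using fun h => hb (hA a ha b h)
      · simpa using fun h => ha (hA b hb a h.symm)
      · simp }

noncomputable def isoBotSumBot (m n : ℕ) :
    (⊥ : SimpleGraph (Fin m)) ⊕g (⊥ : SimpleGraph (Fin n)) ≃g (⊥ : SimpleGraph (Fin (m + n))) :=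
  { toEquiv := finSumFinEquiv
    map_rel_iff' := by rintro (a | a) (b | b) <;> simp }

noncomputable def isoBotOfCard {V : Type*} [Fintype V] (n : ℕ) (h : Fintype.card V = n) :
    (⊥ : SimpleGraph V) ≃g (⊥ : SimpleGraph (Fin n)) :=
  { toEquiv := Fintype.equivFinOfCardEq h
    map_rel_iff' := by simp }

-- Induction on the order, removing one small component at a time. The exponent `a` counts all
-- removed components, `b` only the K₂ ones; `U` may end up empty.
universe u in
theorem exists_noSmallComponent_part {V : Type u} [hV : Fintype V] (G : SimpleGraph V) :
    ∃ (U : Type u) (_ : Fintype U) (K : SimpleGraph U) (a b : ℕ), NoSmallComponent K ∧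
      powerDomGenPoly G = X ^ a * (X + 2) ^ b * powerDomGenPoly K ∧
      (b = 0 → Nonempty (G ≃g K ⊕g (⊥ : SimpleGraph (Fin a)))) := by
  classical
  induction hn : Fintype.card V using Nat.strong_induction_on generalizing V with
  | _ n ih =>
    subst hn
    by_cases h1 : ∃ v, ∀ w, ¬ G.Adj v w
    · obtain ⟨v, hv⟩ := h1
      obtain ⟨U, hU, K, a, b, hK, hQ, hI⟩ := ih _
        (Fintype.card_lt_of_injective_of_notMem (β := V) (Subtype.val : ({v}ᶜ : Set V) → V)
          Subtype.val_injective (b := v) (by simp)) (G.induce {v}ᶜ) rfl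
      let e := isoSumInduceCompl G {v} fun x hx y hxy => by
        obtain rfl : x = v := hx
        exact absurd hxy (hv y)
      have hbot : G.induce {v} = ⊥ := by
        ext ⟨x, hx⟩ ⟨y, hy⟩
        obtain rfl : x = v := hx
        obtain rfl : y = x := hy
        simp
      rw [hbot] at e
      refine ⟨U, hU, K, a + 1, b, hK, ?_, fun hb => ?_⟩
      · rw [powerDomGenPoly_congr e, powerDomGenPoly_sum, hQ, powerDomGenPoly_bot]
        simp
        ring
      · obtain ⟨f⟩ := hI hb
        exact ⟨e.trans <| (SimpleGraph.Iso.sumCongr (isoBotOfCard 1 (by simp)) f).trans <|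
          SimpleGraph.Iso.sumComm.trans <| SimpleGraph.Iso.sumAssoc.trans <|
          SimpleGraph.Iso.sumCongr (.refl) (isoBotSumBot a 1)⟩
    push Not at h1
    by_cases h2 : ∃ v w, G.Adj v w ∧ ∀ u, u ≠ v → u ≠ w → ¬ G.Adj v u ∧ ¬ G.Adj w u
    · obtain ⟨v, w, hvw, h⟩ := h2
      obtain ⟨U, hU, K, a, b, hK, hQ, hI⟩ := ih _
        (Fintype.card_lt_of_injective_of_notMem (β := V) (Subtype.val : ({v, w}ᶜ : Set V) → V)
          Subtype.val_injective (b := v) (by simp)) (G.induce {v, w}ᶜ) rfl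
      let e := isoSumInduceCompl G {v, w} fun x hx y hxy => by
        by_contra hy
        simp only [Set.mem_insert_iff, Set.mem_singleton_iff, not_or] at hx hy
        rcases hx with rfl | rfl
        · exact (h y hy.1 hy.2).1 hxy
        · exact (h y hy.1 hy.2).2 hxy
      have htop : G.induce {v, w} = ⊤ := by
        ext ⟨x, hx⟩ ⟨y, hy⟩
        rcases hx with rfl | rfl <;> rcases hy with rfl | rfl
        · simp
        · exact iff_of_true hvw fun h => hvw.ne (congrArg Subtype.val h)
        · exact iff_of_true hvw.symm fun h => hvw.ne' (congrArg Subtype.val h)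
        · simp
      rw [htop] at e
      have hcard : Fintype.card ({v, w} : Set V) = 2 := by
        simpa using Finset.card_pair hvw.ne
      let f : (⊤ : SimpleGraph ({v, w} : Set V)) ≃g (⊤ : SimpleGraph (Fin 2)) :=
        { toEquiv := Fintype.equivFinOfCardEq hcard
          map_rel_iff' := by simp }
      refine ⟨U, hU, K, a + 1, b + 1, hK, ?_, fun hb => by omega⟩
      rw [powerDomGenPoly_congr e, powerDomGenPoly_sum, hQ, powerDomGenPoly_congr f,
        powerDomGenPoly_top_two]
      ring
    · push Not at h2
      refine ⟨V, hV, G, 0, 0, ⟨h1, fun v w hvw => ?_⟩, by simp, fun _ => ?_⟩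
      · obtain ⟨u, hu⟩ := h2 v w hvw
        exact ⟨u, hu.1, hu.2.1, or_iff_not_imp_left.2 hu.2.2⟩
      · exact ⟨{ toEquiv := (Equiv.sumEmpty V (Fin 0)).symm
                 map_rel_iff' := by intro a b; exact SimpleGraph.sum_adj_inl }⟩

end Clean

/-! ### Small sets whose complement is not power dominating. -/

section BadTriples

variable {V : Type*} {G : SimpleGraph V}

lemma PowerColored.mono {S S' : Set V} (hS : S ⊆ S') {v : V} (h : PowerColored G S v) :
    PowerColored G S' v := by
  induction h with
  | initial h => exact .initial (hS h)
  | dominate h h' => exact .dominate (hS h) h'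
  | force _ h' _ ih ih' => exact .force ih h' ih'

/-- A set of at most three vertices whose complement is not power dominating consists of a vertex
and two neighbors of it that have no neighbors outside of the set. -/
lemma NoSmallComponent.exists_center [DecidableEq V] (hG : NoSmallComponent G) {B : Finset V}
    (hB : B.card ≤ 3) (h : ¬ IsPowerDominating G ((B : Set V)ᶜ)) :
    ∃ a b c, a ≠ b ∧ a ≠ c ∧ b ≠ c ∧ B = {a, b, c} ∧ G.Adj a b ∧ G.Adj a c ∧
      (∀ x, G.Adj b x → x ∈ B) ∧ (∀ x, G.Adj c x → x ∈ B) := by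
  set P := PowerColored G ((B : Set V)ᶜ) with hP
  have hmem : ∀ u, ¬ P u → u ∈ B := fun u hu => by
    by_contra hb
    exact hu (.initial (by simpa using hb))
  have hnb : ∀ u, ¬ P u → ∀ x, G.Adj u x → x ∈ B := fun u hu x hx => by
    by_contra hb
    exact hu (.dominate (v := x) (by simpa using hb) hx.symm)
  have hforce : ∀ x u, P x → ¬ P u → G.Adj x u → ∃ u', ¬ P u' ∧ u' ≠ u ∧ G.Adj x u' := by
    intro x u hx hu hxu
    by_contra! hc
    exact hu (.force hx hxu fun w hw hne => by_contra fun hn => hc w hn hne hw)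
  -- Uncolored vertices and all their neighbors lie in `B`, so a vertex with two uncolored neighbors
  -- already accounts for three elements of `B`.
  suffices H : ∃ a b c, b ≠ c ∧ ¬ P b ∧ ¬ P c ∧ G.Adj a b ∧ G.Adj a c by
    obtain ⟨a, b, c, hbc, hb, hc, hab, hac⟩ := H
    refine ⟨a, b, c, hab.ne, hac.ne, hbc, ?_, hab, hac, hnb b hb, hnb c hc⟩
    symm
    refine Finset.eq_of_subset_of_card_le ?_ ?_
    · intro x hx
      simp only [Finset.mem_insert, Finset.mem_singleton] at hx
      rcases hx with rfl | rfl | rfl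
      exacts [hnb b hb _ hab.symm, hmem _ hb, hmem _ hc]
    · rwa [Finset.card_eq_three.2 ⟨a, b, c, hab.ne, hac.ne, hbc, rfl⟩]
  -- On a path y–x–u with `x`, `u` uncolored, the center is `x` if `y` is uncolored; otherwise it is
  -- `y`, which cannot force `x` and so has a second uncolored neighbor.
  have key : ∀ x y u, ¬ P x → ¬ P u → G.Adj x y → G.Adj x u → y ≠ u →
      ∃ a b c, b ≠ c ∧ ¬ P b ∧ ¬ P c ∧ G.Adj a b ∧ G.Adj a c := by
    intro x y u hx hu hxy hxu hyu
    by_cases hy : P y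
    · obtain ⟨u', h1, h2, h3⟩ := hforce y x hy hx hxy.symm
      exact ⟨y, x, u', h2.symm, hx, h1, hxy.symm, h3⟩
    · exact ⟨x, y, u, hyu, hy, hu, hxy, hxu⟩
  obtain ⟨u, hu⟩ : ∃ u, ¬ P u := by simpa [IsPowerDominating] using h
  obtain ⟨x, hux⟩ := hG.1 u
  by_cases hx : P x
  · obtain ⟨u', h1, h2, h3⟩ := hforce x u hx hu hux.symm
    exact ⟨x, u, u', h2.symm, hu, h1, hux.symm, h3⟩
  · obtain ⟨y, hyu, hyx, h | h⟩ := hG.2 u x hux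
    · exact key u y x hu hx h hux hyx
    · exact key x y u hx hu h hux.symm hyu

end BadTriples

/-! ### A power dominating set in which every vertex has two private neighbors. -/

section PrivateNeighbors

variable {V : Type*} {G : SimpleGraph V}

/-- `w` is a private neighbor of `v` outside of `S`. -/
def IsPrivateNeighbor (G : SimpleGraph V) (S : Set V) (v w : V) : Prop :=
  w ∉ S ∧ G.Adj v w ∧ ∀ s ∈ S, G.Adj s w → s = v

/-- The domination step of `v` is not needed: the other elements of `S` color all neighbors of `v`
except possibly one private neighbor, which `v` then forces once it is colored. -/
lemma IsPowerDominating.of_private {S S' : Set V} (h : IsPowerDominating G S) {v : V}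
    (hS' : ∀ s ∈ S, s ≠ v → s ∈ S') (hv : PowerColored G S' v)
    (hp : ∀ w w', IsPrivateNeighbor G S v w → IsPrivateNeighbor G S v w' → w = w') :
    IsPowerDominating G S' := by
  have h1 : ∀ w, G.Adj v w → ¬ IsPrivateNeighbor G S v w → PowerColored G S' w := by
    intro w hw hn
    by_cases hwS : w ∈ S
    · exact .initial (hS' w hwS hw.ne')
    · simp only [IsPrivateNeighbor, not_and, not_forall] at hn
      obtain ⟨s, hs, hsw, hne⟩ := hn hwS hw
      exact .dominate (hS' s hs hne) hsw
  have h2 : ∀ w, G.Adj v w → PowerColored G S' w := by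
    intro w hw
    by_cases hn : IsPrivateNeighbor G S v w
    · exact .force hv hw fun u hu hne => h1 u hu fun hpu => hne (hp _ _ hpu hn)
    · exact h1 w hw hn
  intro x
  induction h x with
  | @initial a ha =>
    by_cases hav : a = v
    · exact hav ▸ hv
    · exact .initial (hS' a ha hav)
  | @dominate a w ha h' =>
    by_cases hav : a = v
    · exact h2 w (hav ▸ h')
    · exact .dominate (hS' a ha hav) h'
  | force _ h' _ ih ih' => exact .force ih h' ih'

lemma exists_optimal_powerDominating [Fintype V] (G : SimpleGraph V) (f g : Finset V → ℕ) :
    ∃ S : Finset V, IsPowerDominating G (S : Set V) ∧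
      ∀ S' : Finset V, IsPowerDominating G (S' : Set V) → S.card ≤ S'.card ∧
        (S'.card = S.card → f S' ≤ f S ∧ (f S' = f S → g S' ≤ g S)) := by
  classical
  obtain ⟨S₁, h₁, m₁⟩ := (Finset.univ.filter fun S : Finset V =>
    IsPowerDominating G (S : Set V)).exists_min_image Finset.card
      ⟨Finset.univ, Finset.mem_filter.2 ⟨Finset.mem_univ _, fun v => .initial (Finset.mem_univ v)⟩⟩
  simp only [Finset.mem_filter, Finset.mem_univ, true_and] at h₁ m₁
  obtain ⟨S₂, h₂, m₂⟩ := (Finset.univ.filter fun S : Finset V =>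
    IsPowerDominating G (S : Set V) ∧ S.card = S₁.card).exists_max_image f ⟨S₁, by simpa using h₁⟩
  simp only [Finset.mem_filter, Finset.mem_univ, true_and] at h₂ m₂
  obtain ⟨S₃, h₃, m₃⟩ := (Finset.univ.filter fun S : Finset V =>
    IsPowerDominating G (S : Set V) ∧ S.card = S₁.card ∧ f S = f S₂).exists_max_image g
      ⟨S₂, by simpa using h₂⟩
  simp only [Finset.mem_filter, Finset.mem_univ, true_and] at h₃ m₃
  refine ⟨S₃, h₃.1, fun S' hS' => ⟨h₃.2.1 ▸ m₁ S' hS', fun hc => ⟨?_, fun hf => ?_⟩⟩⟩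
  · rw [h₃.2.2]
    exact m₂ S' ⟨hS', hc.trans h₃.2.1⟩
  · exact m₃ S' ⟨hS', hc.trans h₃.2.1, hf.trans h₃.2.2⟩

/-- Exchange argument on a set that is first smallest, then has most inner edges, then has most
vertices of degree at least two. A vertex with at most one private neighbor could be deleted or
moved to a neighbor, improving one of the three. -/
theorem NoSmallComponent.exists_two_private [Fintype V] (hG : NoSmallComponent G) :
    ∃ S : Finset V, IsPowerDominating G (S : Set V) ∧ ∀ v ∈ S, ∃ w w', w ≠ w' ∧
      IsPrivateNeighbor G S v w ∧ IsPrivateNeighbor G S v w' := by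
  classical
  let E : Finset V → Finset (V × V) := fun S =>
    Finset.univ.filter fun p => p.1 ∈ S ∧ p.2 ∈ S ∧ G.Adj p.1 p.2
  let D : Finset V → Finset V := fun S =>
    S.filter fun x => ∃ y z, y ≠ z ∧ G.Adj x y ∧ G.Adj x z
  obtain ⟨S, hS, hopt⟩ := exists_optimal_powerDominating G (fun S => (E S).card)
    (fun S => (D S).card)
  refine ⟨S, hS, fun v hv => ?_⟩
  by_contra! hc
  have hp : ∀ w w', IsPrivateNeighbor G S v w → IsPrivateNeighbor G S v w' → w = w' :=
    fun w w' h h' => by_contra fun hne => hc w w' hne h h'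
  -- A neighbor in `S` would color `v`, so `v` could be deleted.
  have hnadj : ∀ s ∈ S, ¬ G.Adj s v := by
    intro s hs hsv
    have := (hopt (S.erase v) (hS.of_private (v := v) (by simp +contextual)
      (.dominate (v := s) (by simp [hs, hsv.ne]) hsv) hp)).1
    have := Finset.card_erase_lt_of_mem hv
    omega
  have hES : ∀ w, E S ⊆ E (insert w (S.erase v)) := by
    intro w p hp
    simp only [E, Finset.mem_filter, Finset.mem_univ, true_and] at hp ⊢
    have h1 : p.1 ≠ v := fun h => hnadj _ hp.2.1 (h ▸ hp.2.2.symm)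
    have h2 : p.2 ≠ v := fun h => hnadj _ hp.1 (h ▸ hp.2.2)
    simp [hp, h1, h2]
  have hpd : ∀ w, G.Adj v w → IsPowerDominating G (insert w (S.erase v) : Finset V) := fun w hw =>
    hS.of_private (v := v) (by simp +contextual) (.dominate (v := w) (by simp) hw.symm) hp
  have hcard : ∀ w, G.Adj v w → (insert w (S.erase v)).card = S.card := by
    intro w hw
    rw [Finset.card_insert_of_notMem, Finset.card_erase_add_one hv]
    exact fun h => hnadj w (Finset.mem_of_mem_erase h) hw.symm
  -- As `v` has no neighbor in `S`, moving it to `w` loses no inner edge; a further neighbor of `w`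
  -- in `S` would gain one.
  have hpriv : ∀ w, G.Adj v w → IsPrivateNeighbor G S v w := by
    intro w hw
    refine ⟨fun h => hnadj w h hw.symm, hw, fun s hs hsw => by_contra fun hne => ?_⟩
    have h1 := ((hopt _ (hpd w hw)).2 (hcard w hw)).1
    have h2 : E S ⊂ E (insert w (S.erase v)) := by
      refine Finset.ssubset_iff_of_subset (hES w) |>.2 ⟨(s, w), ?_, ?_⟩
      · simp only [E, Finset.mem_filter, Finset.mem_univ, true_and]
        exact ⟨by simp [Finset.mem_coe.1 hs, show s ≠ v from hne], by simp, hsw⟩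
      · simp only [E, Finset.mem_filter, Finset.mem_univ, true_and]
        exact fun h => hnadj w h.2.1 hw.symm
    exact absurd h1 (not_le.2 (Finset.card_lt_card h2))
  obtain ⟨u, hu⟩ := hG.1 v
  have huniq : ∀ w, G.Adj v w → w = u := fun w hw => hp w u (hpriv w hw) (hpriv u hu)
  obtain ⟨y, hyv, hyu, hy⟩ := hG.2 v u hu
  have huy : G.Adj u y := hy.resolve_left fun h => hyu (huniq y h)
  have h1 := (hopt _ (hpd u hu)).2 (hcard u hu)
  have h2 := h1.2 (le_antisymm h1.1 (Finset.card_le_card (hES u)))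
  -- Now `v` is a leaf, while its neighbor `u` also has the neighbor `y`, so moving `v` to `u`
  -- raises the third quantity.
  have h3 : D S ⊂ D (insert u (S.erase v)) := by
    have hsub : D S ⊆ D (insert u (S.erase v)) := by
      intro x hx
      simp only [D, Finset.mem_filter] at hx ⊢
      refine ⟨?_, hx.2⟩
      have : x ≠ v := by
        rintro rfl
        obtain ⟨-, a, b, hab, ha, hb⟩ := hx
        exact hab ((huniq a ha).trans (huniq b hb).symm)
      simp [hx.1, this]
    refine Finset.ssubset_iff_of_subset hsub |>.2 ⟨u, ?_, ?_⟩
    · simp only [D, Finset.mem_filter]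
      exact ⟨by simp, v, y, hyv.symm, hu.symm, huy⟩
    · simp only [D, Finset.mem_filter]
      exact fun h => hnadj u h.1 hu.symm
  exact absurd h2 (not_le.2 (Finset.card_lt_card h3))

end PrivateNeighbors

/-! ### Private blocks versus bad triples. -/

section Blocks

variable {V : Type*} [Fintype V] {G : SimpleGraph V}

open Classical in
/-- The sets of three vertices whose complement is not power dominating. -/
noncomputable def badTriples (G : SimpleGraph V) : Finset (Finset V) :=
  Finset.univ.filter fun B => B.card = 3 ∧ ¬ IsPowerDominating G ((B : Set V)ᶜ)

open Classical in
/-- A vertex together with its private neighbors outside of `S`. -/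
noncomputable def privateBlock (G : SimpleGraph V) (S : Finset V) (v : V) : Finset V :=
  insert v (Finset.univ.filter fun w => IsPrivateNeighbor G (S : Set V) v w)

lemma mem_privateBlock {S : Finset V} {v w : V} :
    w ∈ privateBlock G S v ↔ w = v ∨ IsPrivateNeighbor G (S : Set V) v w := by
  simp [privateBlock]

lemma disjoint_privateBlock {S : Finset V} {v w : V} (hv : v ∈ S) (hw : w ∈ S) (hne : v ≠ w) :
    Disjoint (privateBlock G S v) (privateBlock G S w) := by
  rw [Finset.disjoint_left]
  intro x hx hx'
  rw [mem_privateBlock] at hx hx'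
  rcases hx with rfl | hx <;> rcases hx' with rfl | hx'
  · exact hne rfl
  · exact hx'.1 hv
  · exact hx.1 hw
  · exact hne (hx'.2.2 v hv hx.2.1)

lemma three_le_card_privateBlock {S : Finset V} {v : V} (hv : v ∈ S)
    (h : ∃ w w', w ≠ w' ∧ IsPrivateNeighbor G (S : Set V) v w ∧
      IsPrivateNeighbor G (S : Set V) v w') : 3 ≤ (privateBlock G S v).card := by
  classical
  obtain ⟨w, w', hne, hw, hw'⟩ := h
  have h1 : ({v, w, w'} : Finset V).card = 3 :=
    Finset.card_eq_three.2 ⟨v, w, w', hw.2.1.ne, hw'.2.1.ne, hne, rfl⟩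
  rw [← h1]
  refine Finset.card_le_card fun x hx => ?_
  simp only [Finset.mem_insert, Finset.mem_singleton] at hx
  rw [mem_privateBlock]
  rcases hx with rfl | rfl | rfl
  exacts [.inl rfl, .inr hw, .inr hw']

lemma three_mul_card_le {S : Finset V} (h : ∀ v ∈ S, 3 ≤ (privateBlock G S v).card) :
    3 * S.card ≤ Fintype.card V := by
  classical
  calc 3 * S.card = ∑ _v ∈ S, 3 := by simp [mul_comm]
    _ ≤ ∑ v ∈ S, (privateBlock G S v).card := Finset.sum_le_sum h
    _ = (S.biUnion (privateBlock G S)).card :=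
        (Finset.card_biUnion fun v hv w hw hne => disjoint_privateBlock hv hw hne).symm
    _ ≤ Fintype.card V := Finset.card_le_univ _

/-- Equality case of the count behind `three_mul_card_le`. -/
lemma privateBlock_partition {S : Finset V} (h : ∀ v ∈ S, 3 ≤ (privateBlock G S v).card)
    (hS : 3 * S.card = Fintype.card V) :
    (∀ v ∈ S, (privateBlock G S v).card = 3) ∧ ∀ x, ∃ v ∈ S, x ∈ privateBlock G S v := by
  classical
  have h1 : (S.biUnion (privateBlock G S)).card = ∑ v ∈ S, (privateBlock G S v).card :=
    Finset.card_biUnion fun v hv w hw hne => disjoint_privateBlock hv hw hne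
  have h2 : ∑ _v ∈ S, 3 ≤ ∑ v ∈ S, (privateBlock G S v).card := Finset.sum_le_sum h
  have h3 : ∑ _v ∈ S, 3 = Fintype.card V := by simp [← hS, mul_comm]
  have h4 := Finset.card_le_univ (S.biUnion (privateBlock G S))
  refine ⟨fun v hv => ((Finset.sum_eq_sum_iff_of_le h).1 (by omega) v hv).symm, fun x => ?_⟩
  have h5 : S.biUnion (privateBlock G S) = Finset.univ :=
    (Finset.card_eq_iff_eq_univ _).1 (by omega)
  have h6 := Finset.mem_univ x
  rw [← h5] at h6
  simpa using h6

/-- Let `a` be the center of the triple. If `b` or `c` is in `S`, its block stays inside the triple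
because its neighbors do. Otherwise `a ∈ S`, since `S` must meet the triple, and `b`, `c` are
private neighbors of `a`. Both sets have three elements. -/
lemma eq_privateBlock_of_mem_badTriples (hG : NoSmallComponent G) {S B : Finset V}
    (hS : IsPowerDominating G (S : Set V)) (h : ∀ v ∈ S, (privateBlock G S v).card = 3)
    (hB : B ∈ badTriples G) : ∃ v ∈ S, privateBlock G S v = B := by
  classical
  simp only [badTriples, Finset.mem_filter, Finset.mem_univ, true_and] at hB
  obtain ⟨a, b, c, hab, hac, hbc, rfl, hab', hac', hb, hc⟩ := hG.exists_center hB.1.le hB.2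
  have key : ∀ v ∈ S, (∀ x, G.Adj v x → x ∈ ({a, b, c} : Finset V)) → v ∈ ({a, b, c} : Finset V) →
      privateBlock G S v = {a, b, c} := by
    intro v hv hN hv'
    refine Finset.eq_of_subset_of_card_le (fun x hx => ?_) (by rw [h v hv, hB.1])
    rcases mem_privateBlock.1 hx with rfl | hx
    · exact hv'
    · exact hN x hx.2.1
  by_cases hbS : b ∈ S
  · exact ⟨b, hbS, key b hbS hb (by simp)⟩
  by_cases hcS : c ∈ S
  · exact ⟨c, hcS, key c hcS hc (by simp)⟩
  have haS : a ∈ S := by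
    by_contra haS
    refine hB.2 fun v => (hS v).mono ?_
    intro x hx
    rw [Set.mem_compl_iff]
    intro hx'
    simp only [Finset.coe_insert, Finset.coe_singleton, Set.mem_insert_iff,
      Set.mem_singleton_iff] at hx'
    rcases hx' with rfl | rfl | rfl
    exacts [haS hx, hbS hx, hcS hx]
  have hpriv : ∀ x, x ∉ S → G.Adj a x → (∀ y, G.Adj x y → y ∈ ({a, b, c} : Finset V)) →
      x ∈ privateBlock G S a := by
    refine fun x hx hax hN => mem_privateBlock.2 (.inr ⟨hx, hax, fun s hs hsx => ?_⟩)
    have := hN s hsx.symm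
    simp only [Finset.mem_insert, Finset.mem_singleton] at this
    rcases this with rfl | rfl | rfl
    exacts [rfl, absurd hs hbS, absurd hs hcS]
  refine ⟨a, haS, (Finset.eq_of_subset_of_card_le (fun x hx => ?_) (by rw [h a haS, hB.1])).symm⟩
  simp only [Finset.mem_insert, Finset.mem_singleton] at hx
  rcases hx with rfl | rfl | rfl
  exacts [mem_privateBlock.2 (.inl rfl), hpriv _ hbS hab' hb, hpriv _ hcS hac' hc]

/-- If the private blocks have three vertices each and there are as many bad triples as blocks,
then the blocks are the triples of a graph obtained by attaching pairs of pendant vertices. -/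
theorem exists_iso_attachPendants (hG : NoSmallComponent G) {S : Finset V}
    (hS : IsPowerDominating G (S : Set V)) (h : ∀ v ∈ S, 3 ≤ (privateBlock G S v).card)
    (hcard : 3 * S.card = Fintype.card V) (hbad : S.card ≤ (badTriples G).card) :
    ∃ (H : SimpleGraph S) (T : Set S), Nonempty (G ≃g attachPendants H T) := by
  classical
  obtain ⟨h3, hcover⟩ := privateBlock_partition h hcard
  -- Every bad triple is a block, so by `hbad` every block is a bad triple and has a center.
  have hsub : badTriples G ⊆ S.image (privateBlock G S) := fun B hB => by
    simpa using eq_privateBlock_of_mem_badTriples hG hS h3 hB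
  have hall : ∀ s : S, privateBlock G S s ∈ badTriples G := by
    rintro ⟨s, hs⟩
    rw [Finset.eq_of_subset_of_card_le hsub (Finset.card_image_le.trans hbad)]
    exact Finset.mem_image_of_mem _ hs
  have hex : ∀ s : S, ∃ a b c, a ≠ b ∧ a ≠ c ∧ b ≠ c ∧ privateBlock G S s = {a, b, c} ∧
      G.Adj a b ∧ G.Adj a c ∧ (∀ x, G.Adj b x → x ∈ privateBlock G S s) ∧
        (∀ x, G.Adj c x → x ∈ privateBlock G S s) := by
    intro s
    have hs := hall s
    simp only [badTriples, Finset.mem_filter, Finset.mem_univ, true_and] at hs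
    exact hG.exists_center hs.1.le hs.2
  choose a b c hab hac hbc hblock hab' hac' hb hc using hex
  let f : S × Fin 3 → V := fun x => ![a x.1, b x.1, c x.1] x.2
  have hf : ∀ (s : S) (i : Fin 3), f (s, i) ∈ privateBlock G S s := by
    intro s i
    rw [hblock]
    fin_cases i <;> simp [f]
  have hdisj : ∀ (s t : S) (x : V), x ∈ privateBlock G S s → x ∈ privateBlock G S t → s = t := by
    intro s t x hs ht
    by_contra hne
    exact Finset.disjoint_left.1 (disjoint_privateBlock s.2 t.2 fun h => hne (Subtype.ext h)) hs ht
  have hinj : ∀ (s : S) (i j : Fin 3), f (s, i) = f (s, j) → i = j := by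
    intro s i j hij
    fin_cases i <;> fin_cases j
    exacts [rfl, absurd hij (hab s), absurd hij (hac s), absurd hij.symm (hab s), rfl,
      absurd hij (hbc s), absurd hij.symm (hac s), absurd hij.symm (hbc s), rfl]
  have hbij : Function.Bijective f := by
    constructor
    · rintro ⟨s, i⟩ ⟨t, j⟩ hst
      obtain rfl : s = t := hdisj s t _ (hf s i) (hst ▸ hf t j)
      rw [hinj s i j hst]
    · intro x
      obtain ⟨s, hs, hx⟩ := hcover x
      rw [hblock ⟨s, hs⟩] at hx
      simp only [Finset.mem_insert, Finset.mem_singleton] at hx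
      rcases hx with rfl | rfl | rfl
      exacts [⟨(⟨s, hs⟩, 0), rfl⟩, ⟨(⟨s, hs⟩, 1), rfl⟩, ⟨(⟨s, hs⟩, 2), rfl⟩]
  have hin : ∀ (s : S) (i : Fin 3), i ≠ 0 → ∀ x, G.Adj (f (s, i)) x → x ∈ privateBlock G S s := by
    intro s i hi
    fin_cases i
    exacts [absurd rfl hi, hb s, hc s]
  -- The hub of a block is its center `a s`, which need not be `s` itself.
  refine ⟨G.comap a, {s | G.Adj (b s) (c s)},
    ⟨SimpleGraph.Iso.symm ⟨Equiv.ofBijective f hbij, ?_⟩⟩⟩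
  rintro ⟨s, i⟩ ⟨t, j⟩
  show G.Adj (f (s, i)) (f (t, j)) ↔ _
  by_cases hst : s = t
  · subst hst
    have h1 := hab' s
    have h2 := hac' s
    fin_cases i <;> fin_cases j <;>
      simp [f, attachPendants, h1, h2, h1.symm, h2.symm, G.adj_comm (c s) (b s)]
  · have h0 : G.Adj (f (s, i)) (f (t, j)) → i = 0 ∧ j = 0 := by
      refine fun hadj => ⟨?_, ?_⟩
      · by_contra hi
        exact hst (hdisj s t _ (hin s i hi _ hadj) (hf t j))
      · by_contra hj
        exact hst (hdisj s t _ (hf s i) (hin t j hj _ hadj.symm))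
    constructor
    · intro hadj
      obtain ⟨rfl, rfl⟩ := h0 hadj
      exact Or.inl ⟨rfl, rfl, hadj⟩
    · rintro (⟨hi, hj, hadj⟩ | ⟨h, -⟩)
      · obtain rfl : i = 0 := hi
        obtain rfl : j = 0 := hj
        exact hadj
      · exact absurd h hst

end Blocks

/-! ### Top coefficients of the polynomial. -/

section Coefficients

variable {V : Type*} [Fintype V] {G : SimpleGraph V}

lemma coeff_card_powerDomGenPoly : (powerDomGenPoly G).coeff (Fintype.card V) = 1 := by
  classical
  rw [coeff_powerDomGenPoly]
  have : (Finset.univ.filter fun S : Finset V =>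
      S.card = Fintype.card V ∧ IsPowerDominating G (S : Set V)) = {Finset.univ} := by
    ext S
    simp only [Finset.mem_filter, Finset.mem_univ, true_and, Finset.mem_singleton,
      Finset.card_eq_iff_eq_univ]
    refine ⟨fun h => h.1, fun h => ⟨h, fun v => .initial ?_⟩⟩
    simp [h]
  simp [this]

lemma natDegree_powerDomGenPoly : (powerDomGenPoly G).natDegree = Fintype.card V := by
  classical
  refine natDegree_eq_of_le_of_coeff_ne_zero ?_ (by simp [coeff_card_powerDomGenPoly])
  rw [natDegree_le_iff_coeff_eq_zero]
  intro N hN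
  rw [coeff_powerDomGenPoly, Nat.cast_eq_zero, Finset.card_eq_zero, Finset.filter_eq_empty_iff]
  rintro S - ⟨rfl, -⟩
  exact absurd S.card_le_univ (not_le.2 hN)

lemma monic_powerDomGenPoly : (powerDomGenPoly G).Monic := by
  rw [Monic, leadingCoeff, natDegree_powerDomGenPoly, coeff_card_powerDomGenPoly]

-- Complementation turns the top coefficients into counts of small sets; reversal also makes a
-- factor `X ^ m` disappear.
open Classical in
lemma coeff_reverse_powerDomGenPoly {i : ℕ} (hi : i ≤ Fintype.card V) :
    (powerDomGenPoly G).reverse.coeff i =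
      (Finset.univ.filter fun B : Finset V =>
        B.card = i ∧ IsPowerDominating G ((B : Set V)ᶜ)).card := by
  rw [coeff_reverse, natDegree_powerDomGenPoly, revAt_le hi, coeff_powerDomGenPoly]
  congr 1
  refine Finset.card_bij' (fun S _ => Sᶜ) (fun S _ => Sᶜ) ?_ ?_ (by simp) (by simp)
  · intro S hS
    simp only [Finset.mem_filter, Finset.mem_univ, true_and, Finset.card_compl] at hS ⊢
    exact ⟨by omega, by simpa using hS.2⟩
  · intro S hS
    simp only [Finset.mem_filter, Finset.mem_univ, true_and, Finset.card_compl] at hS ⊢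
    exact ⟨by omega, by simpa using hS.2⟩

lemma NoSmallComponent.coeff_reverse_of_le_two (hG : NoSmallComponent G) {i : ℕ} (hi : i ≤ 2)
    (hi' : i ≤ Fintype.card V) :
    (powerDomGenPoly G).reverse.coeff i = (Fintype.card V).choose i := by
  classical
  rw [coeff_reverse_powerDomGenPoly hi', ← Finset.card_univ, ← Finset.card_powersetCard]
  congr 2
  ext B
  simp only [Finset.mem_filter, Finset.mem_univ, true_and, Finset.mem_powersetCard,
    Finset.subset_univ, and_iff_left_iff_imp]
  intro hB
  by_contra h
  obtain ⟨a, b, c, hab, hac, hbc, hBeq, -⟩ := hG.exists_center (by omega) h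
  have := Finset.card_eq_three.2 ⟨a, b, c, hab, hac, hbc, hBeq⟩
  omega

lemma coeff_three_reverse_add (h : 3 ≤ Fintype.card V) :
    (powerDomGenPoly G).reverse.coeff 3 + (badTriples G).card = (Fintype.card V).choose 3 := by
  classical
  rw [coeff_reverse_powerDomGenPoly h, badTriples, ← Nat.cast_add, ← Finset.filter_filter,
    ← Finset.filter_filter, Finset.card_filter_add_card_filter_not, ← Finset.card_univ,
    ← Finset.card_powersetCard]
  congr 2
  ext B
  simp

lemma NoSmallComponent.three_le_card [Nonempty V] (hG : NoSmallComponent G) :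
    3 ≤ Fintype.card V := by
  classical
  let v := Classical.arbitrary V
  obtain ⟨w, hw⟩ := hG.1 v
  obtain ⟨u, huv, huw, -⟩ := hG.2 v w hw
  rw [← Finset.card_eq_three.2 ⟨v, w, u, hw.ne, huv.symm, huw.symm, rfl⟩]
  exact Finset.card_le_univ _

end Coefficients

/-! ### Monic integer polynomials and minimal polynomials. -/

section IntegerPolynomials

lemma two_mul_cast_choose_two (n : ℕ) : 2 * (n.choose 2 : ℤ) = n * (n - 1) := by
  induction n with
  | zero => simp
  | succ n ih =>
    rw [Nat.choose_succ_succ' n 1, Nat.choose_one_right]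
    push_cast
    linear_combination ih

lemma six_mul_cast_choose_three (n : ℕ) : 6 * (n.choose 3 : ℤ) = n * (n - 1) * (n - 2) := by
  induction n with
  | zero => simp
  | succ n ih =>
    rw [Nat.choose_succ_succ' n 2]
    push_cast
    linear_combination ih + 3 * two_mul_cast_choose_two n

lemma reverse_X_sub_C (a : ℤ) : (X - C a).reverse = 1 - C a * X := by
  have h := reverse_add_C (X : ℤ[X]) (-a)
  rw [natDegree_X, pow_one, C_neg, ← sub_eq_add_neg] at h
  rw [h, ← mul_one (X : ℤ[X]), reverse_X_mul, ← C_1, reverse_C]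
  simp [sub_eq_add_neg]

/-- Vieta's formulas, with the second symmetric function expressed by power sums. -/
lemma coeff_reverse_prod_X_sub_C (s : Multiset ℤ) :
    (s.map fun a => X - C a).prod.reverse.coeff 0 = 1 ∧
    (s.map fun a => X - C a).prod.reverse.coeff 1 = -s.sum ∧
    2 * (s.map fun a => X - C a).prod.reverse.coeff 2 = s.sum ^ 2 - (s.map fun a => a ^ 2).sum := by
  induction s using Multiset.induction_on with
  | empty =>
    have h : (1 : ℤ[X]).reverse = 1 := by rw [← C_1, reverse_C]
    simp [h, coeff_one]
  | cons a s ih =>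
    obtain ⟨h0, h1, h2⟩ := ih
    simp only [Multiset.map_cons, Multiset.prod_cons, Multiset.sum_cons, reverse_mul_of_domain,
      reverse_X_sub_C]
    generalize (s.map fun a => X - C a).prod.reverse = A at *
    have e : (1 - C a * X) * A = A - C a * (A * X) := by ring
    rw [e]
    simp only [coeff_sub, coeff_C_mul, coeff_mul_X_zero,
      show A.coeff 1 = A.coeff (0 + 1) from rfl, show A.coeff 2 = A.coeff (1 + 1) from rfl,
      show (A * X).coeff 1 = A.coeff 0 from coeff_mul_X A 0,
      show (A * X).coeff 2 = A.coeff 1 from coeff_mul_X A 1] at *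
    refine ⟨by simp [h0], by rw [h0, h1]; ring, ?_⟩
    rw [h1]
    linear_combination h2

lemma reverse_quadratic (p q : ℤ) :
    (X ^ 2 + C p * X + C q : ℤ[X]).reverse = 1 + C p * X + C q * X ^ 2 := by
  have hd : (X + C p : ℤ[X]).natDegree = 1 := natDegree_X_add_C p
  have h1 : (X + C p : ℤ[X]).reverse = 1 + C p * X := by
    simpa using reverse_X_sub_C (-p)
  have e : (X ^ 2 + C p * X + C q : ℤ[X]) = (X + C p) * X + C q := by ring
  rw [e, reverse_add_C, reverse_mul_X, h1, natDegree_mul_X (X_add_C_ne_zero p),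
    hd]

/-- The factors 2 and 6 clear the denominators of the binomial coefficients in `k`. -/
lemma coeff_quadratic_pow (p q : ℤ) (k : ℕ) :
    ((1 + C p * X + C q * X ^ 2 : ℤ[X]) ^ k).coeff 0 = 1 ∧
    ((1 + C p * X + C q * X ^ 2 : ℤ[X]) ^ k).coeff 1 = k * p ∧
    2 * ((1 + C p * X + C q * X ^ 2 : ℤ[X]) ^ k).coeff 2 = 2 * k * q + k * (k - 1) * p ^ 2 ∧
    6 * ((1 + C p * X + C q * X ^ 2 : ℤ[X]) ^ k).coeff 3 =
      6 * k * (k - 1) * p * q + k * (k - 1) * (k - 2) * p ^ 3 := by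
  induction k with
  | zero => simp [coeff_one]
  | succ k ih =>
    obtain ⟨h0, h1, h2, h3⟩ := ih
    rw [pow_succ]
    generalize (1 + C p * X + C q * X ^ 2 : ℤ[X]) ^ k = A at *
    have e : A * (1 + C p * X + C q * X ^ 2) = A + C p * (A * X) + C q * (A * X * X) := by ring
    rw [e]
    simp only [coeff_add, coeff_C_mul, coeff_mul_X_zero,
      show ∀ B : ℤ[X], (B * X).coeff 1 = B.coeff 0 from fun B => coeff_mul_X B 0,
      show ∀ B : ℤ[X], (B * X).coeff 2 = B.coeff 1 from fun B => coeff_mul_X B 1,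
      show ∀ B : ℤ[X], (B * X).coeff 3 = B.coeff 2 from fun B => coeff_mul_X B 2]
    push_cast
    refine ⟨by simp [h0], ?_, ?_, ?_⟩
    · rw [h0, h1]; ring
    · rw [h0, h1]; linear_combination h2
    · rw [h1]; linear_combination h3 + 3 * p * h2

lemma minpoly_eq_of_aeval_eq_zero {α z : ℂ} (hα : IsIntegral ℤ α)
    (hz : aeval z (minpoly ℤ α) = 0) : minpoly ℤ z = minpoly ℤ α := by
  have hz' : IsIntegral ℤ z := ⟨_, minpoly.monic hα, by rwa [aeval_def] at hz⟩
  exact eq_of_monic_of_associated (minpoly.monic hz') (minpoly.monic hα)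
    ((minpoly.irreducible hz').associated_of_dvd (minpoly.irreducible hα)
      (minpoly.isIntegrallyClosed_dvd hz' hz))

lemma aeval_intCast_minpoly_ne_zero {α : ℂ} (hα : IsIntegral ℤ α)
    (hα' : α ∉ (algebraMap ℤ ℂ).range) (a : ℤ) : aeval (a : ℂ) (minpoly ℤ α) ≠ 0 := by
  intro h
  have h1 := minpoly_eq_of_aeval_eq_zero hα h
  rw [← minpoly.natDegree_eq_one_iff, ← h1, minpoly.natDegree_eq_one_iff] at hα'
  exact hα' ⟨a, by simp⟩

/-- A monic integer polynomial whose only roots are `0` and the conjugates of `α`. -/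
lemma eq_X_pow_mul_minpoly_pow {α : ℂ} (hα : IsIntegral ℤ α) (Q : ℤ[X]) (hQ : Q.Monic)
    (hroots : ∀ z : ℂ, aeval z Q = 0 → z = 0 ∨ aeval z (minpoly ℤ α) = 0) :
    ∃ m k : ℕ, Q = X ^ m * minpoly ℤ α ^ k := by
  induction hn : Q.natDegree using Nat.strong_induction_on generalizing Q with
  | _ n ih =>
    subst hn
    by_cases h0 : Q.natDegree = 0
    · exact ⟨0, 0, by simpa using hQ.natDegree_eq_zero.1 h0⟩
    -- Any complex root of `Q` allows `X` or the minimal polynomial to be divided out.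
    have step : ∀ f : ℤ[X], f.Monic → 0 < f.natDegree → f ∣ Q →
        ∃ Q', Q = f * Q' ∧ ∃ m k : ℕ, Q' = X ^ m * minpoly ℤ α ^ k := by
      rintro f hf hdeg ⟨Q', rfl⟩
      have hQ' := hf.of_mul_monic_left hQ
      refine ⟨Q', rfl, ih _ ?_ Q' hQ' (fun z hz => hroots z (by simp [hz])) rfl⟩
      rw [hf.natDegree_mul hQ']
      omega
    obtain ⟨z, hz⟩ : ∃ z : ℂ, aeval z Q = 0 := by
      obtain ⟨z, hz⟩ := Complex.exists_root (f := Q.map (algebraMap ℤ ℂ)) (by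
        rw [← natDegree_pos_iff_degree_pos, hQ.natDegree_map]
        omega)
      exact ⟨z, by rwa [IsRoot, eval_map_algebraMap] at hz⟩
    rcases hroots z hz with rfl | hz'
    · obtain ⟨Q', h, m, k, rfl⟩ := step X monic_X (by simp) (by
        rw [X_dvd_iff]
        simpa [aeval_def, eval₂_at_zero] using hz)
      exact ⟨m + 1, k, by rw [h]; ring⟩
    · have hz'' : IsIntegral ℤ z := ⟨Q, hQ, by rwa [aeval_def] at hz⟩
      obtain ⟨Q', h, m, k, rfl⟩ := step (minpoly ℤ α) (minpoly.monic hα) (minpoly.natDegree_pos hα) (by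
        rw [← minpoly_eq_of_aeval_eq_zero hα hz']
        exact minpoly.isIntegrallyClosed_dvd hz'' hz)
      exact ⟨m, k + 1, by rw [h]; ring⟩

/-- Irreducible polynomials over ℚ are separable, so the roots are simple. -/
lemma ncard_roots_minpoly {α : ℂ} (hα : IsIntegral ℤ α) :
    {z : ℂ | aeval z (minpoly ℤ α) = 0}.ncard = (minpoly ℤ α).natDegree := by
  classical
  set g := (minpoly ℤ α).map (algebraMap ℤ ℂ) with hg
  have hmon : g.Monic := (minpoly.monic hα).map _
  have hsep : g.Separable := by
    have h1 : (minpoly ℚ α).Separable := (minpoly.irreducible hα.tower_top).separable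
    have h2 := h1.map (f := algebraMap ℚ ℂ)
    rwa [minpoly.isIntegrallyClosed_eq_field_fractions' ℚ hα, map_map,
      ← IsScalarTower.algebraMap_eq] at h2
  have hset : {z : ℂ | aeval z (minpoly ℤ α) = 0} = (g.roots.toFinset : Set ℂ) := by
    ext z
    rw [Finset.mem_coe, Multiset.mem_toFinset, mem_roots hmon.ne_zero, IsRoot, hg,
      eval_map_algebraMap, Set.mem_ofPred_eq]
  rw [hset, Set.ncard_coe_finset, Multiset.toFinset_card_of_nodup (nodup_roots hsep),
    ← (IsAlgClosed.splits g).natDegree_eq_card_roots, (minpoly.monic hα).natDegree_map]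

end IntegerPolynomials

/-! ### Roots of graphs without small components. -/

section Roots

variable {V : Type*} [Fintype V] {G : SimpleGraph V}

lemma coeff_zero_powerDomGenPoly [Nonempty V] : (powerDomGenPoly G).coeff 0 = 0 := by
  classical
  rw [coeff_powerDomGenPoly, Nat.cast_eq_zero, Finset.card_eq_zero, Finset.filter_eq_empty_iff]
  rintro S - ⟨h, hS⟩
  obtain ⟨x, hx⟩ := (hS (Classical.arbitrary V)).nonempty
  rw [Finset.card_eq_zero] at h
  simp [h] at hx

lemma aeval_zero_powerDomGenPoly [Nonempty V] : aeval (0 : ℂ) (powerDomGenPoly G) = 0 := by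
  rw [aeval_def, eval₂_at_zero, coeff_zero_powerDomGenPoly, map_zero]

/-- The coefficients n and C(n,2) say that n integer roots would have sum -n and sum of squares n.
Then Σ(a² + a) = 0 with nonnegative terms puts all roots in {0, -1}, and the sum makes them all -1,
although 0 is a root. -/
theorem NoSmallComponent.exists_root_not_int [Nonempty V] (hG : NoSmallComponent G) :
    ∃ α : ℂ, aeval α (powerDomGenPoly G) = 0 ∧ α ∉ (algebraMap ℤ ℂ).range := by
  by_contra! hc
  set Q := powerDomGenPoly G with hQ
  have hmon : Q.Monic := monic_powerDomGenPoly
  have h1 := (IsAlgClosed.splits (Q.map (algebraMap ℤ ℂ))).eq_prod_roots_of_monic (hmon.map _)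
  have h2 : ∀ z ∈ (Q.map (algebraMap ℤ ℂ)).roots, ∃ a : ℤ, (a : ℂ) = z := by
    intro z hz
    obtain ⟨a, ha⟩ := hc z (by
      rwa [mem_roots (hmon.map _).ne_zero, IsRoot, eval_map_algebraMap] at hz)
    exact ⟨a, by simpa using ha⟩
  obtain ⟨s, hs⟩ : ∃ s : Multiset ℤ, s.map (Int.cast : ℤ → ℂ) = (Q.map (algebraMap ℤ ℂ)).roots := by
    generalize (Q.map (algebraMap ℤ ℂ)).roots = r at h2
    induction r using Multiset.induction_on with
    | empty => exact ⟨0, rfl⟩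
    | cons z r ih =>
      obtain ⟨s, rfl⟩ := ih fun w hw => h2 w (Multiset.mem_cons_of_mem hw)
      obtain ⟨a, rfl⟩ := h2 z (Multiset.mem_cons_self _ _)
      exact ⟨a ::ₘ s, Multiset.map_cons _ _ _⟩
  have h3 : Q = (s.map fun a => X - C a).prod := by
    apply map_injective (algebraMap ℤ ℂ) (RingHom.injective_int _)
    rw [h1, ← hs, Polynomial.map_multiset_prod, Multiset.map_map, Multiset.map_map]
    simp
  obtain ⟨-, c1, c2⟩ := coeff_reverse_prod_X_sub_C s
  have hcard := hG.three_le_card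
  rw [← h3, hG.coeff_reverse_of_le_two (by omega) (by omega)] at c1 c2
  rw [two_mul_cast_choose_two] at c2
  rw [Nat.choose_one_right] at c1
  have hdeg : s.card = Fintype.card V := by
    rw [← natDegree_powerDomGenPoly (G := G), ← hQ, h3, natDegree_multiset_prod_X_sub_C_eq_card]
  have h4 : (s.map fun a => a ^ 2 + a).sum = 0 := by
    rw [Multiset.sum_map_add, Multiset.map_id']
    nlinarith
  have h5 : ∀ a ∈ s, a ^ 2 + a = 0 := by
    have := Multiset.all_zero_of_le_zero_le_of_sum_eq_zero (s := s.map fun a => a ^ 2 + a)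
      (by
        simp only [Multiset.mem_map, forall_exists_index, and_imp, forall_apply_eq_imp_iff₂]
        intro a _
        rcases le_or_gt 0 a with h | h <;> nlinarith) h4
    simpa using this
  have h6 : (s.map fun a => a + 1).sum = 0 := by
    rw [Multiset.sum_map_add, Multiset.map_id', Multiset.map_const', Multiset.sum_replicate, hdeg]
    simp
    linarith
  have h7 := Multiset.all_zero_of_le_zero_le_of_sum_eq_zero (s := s.map fun a => a + 1)
      (by
        simp only [Multiset.mem_map, forall_exists_index, and_imp, forall_apply_eq_imp_iff₂]
        intro a ha
        have := h5 a ha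
        by_contra! hlt
        nlinarith) h6
  have h0 : (0 : ℤ) ∈ s := by
    have h8 : Q.eval 0 = 0 := by
      rw [← coeff_zero_eq_eval_zero]
      exact coeff_zero_powerDomGenPoly
    rw [h3, eval_multiset_prod, Multiset.prod_eq_zero_iff] at h8
    simpa using h8
  have := h7 1 (Multiset.mem_map.2 ⟨0, h0, by simp⟩)
  omega

/-- The shape of the polynomial of a graph without small components determines the graph up to
the choice of the edges between hubs and between the two pendant vertices of each hub. -/
theorem NoSmallComponent.exists_iso_of_eq_mul_pow [Nonempty V] (hG : NoSmallComponent G)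
    {m k : ℕ} {p q : ℤ} (hq : q ≠ 0)
    (h : powerDomGenPoly G = X ^ m * (X ^ 2 + C p * X + C q) ^ k) :
    (p = 3 ∧ q = 3) ∧ ∃ (S : Finset V) (H : SimpleGraph S) (T : Set S),
      S.Nonempty ∧ Nonempty (G ≃g attachPendants H T) := by
  classical
  obtain ⟨S, hS, hpriv⟩ := hG.exists_two_private
  have hblock : ∀ v ∈ S, 3 ≤ (privateBlock G S v).card := fun v hv =>
    three_le_card_privateBlock hv (hpriv v hv)
  have hSle := three_mul_card_le hblock
  set n := Fintype.card V with hn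
  have hn3 : 3 ≤ n := hG.three_le_card
  have hrev : (powerDomGenPoly G).reverse = (1 + C p * X + C q * X ^ 2) ^ k := by
    rw [h, reverse_X_pow_mul, ← reverse_quadratic]
    clear h
    induction k with
    | zero => rw [pow_zero, pow_zero, ← C_1, reverse_C]
    | succ k ih => rw [pow_succ _ k, reverse_mul_of_domain, ih, pow_succ _ k]
  obtain ⟨-, c1, c2, c3⟩ := coeff_quadratic_pow p q k
  rw [← hrev] at c1 c2 c3
  rw [hG.coeff_reverse_of_le_two (by omega) (by omega), Nat.choose_one_right, ← hn] at c1
  rw [hG.coeff_reverse_of_le_two (by omega) (by omega), two_mul_cast_choose_two, ← hn] at c2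
  have c3' := coeff_three_reverse_add (G := G) hn3
  have hdeg2 : (X ^ 2 + C p * X + C q : ℤ[X]).natDegree = 2 := by compute_degree!
  have hdeg : n = m + 2 * k := by
    have hm : (X ^ 2 + C p * X + C q : ℤ[X]).Monic := by monicity!
    rw [hn, ← natDegree_powerDomGenPoly (G := G), h, (monic_X_pow m).natDegree_mul (hm.pow k),
      hm.natDegree_pow, hdeg2, natDegree_X_pow]
    ring
  have hm1 : 1 ≤ m := by
    by_contra! hm
    have h0 := coeff_zero_powerDomGenPoly (G := G)
    rw [h, show m = 0 by omega, pow_zero, one_mul, coeff_zero_eq_eval_zero] at h0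
    simp at h0
    exact hq h0.1
  -- The factor `X ^ m` excludes power dominating sets with fewer than `m` elements.
  have hmS : m ≤ S.card := by
    by_contra! hlt
    have h1 : (powerDomGenPoly G).coeff S.card = 0 := by
      rw [h, mul_comm, coeff_mul_X_pow', if_neg (by omega)]
    rw [coeff_powerDomGenPoly, Nat.cast_eq_zero, Finset.card_eq_zero,
      Finset.filter_eq_empty_iff] at h1
    exact h1 (Finset.mem_univ S) ⟨rfl, hS⟩
  have hk : 0 < (k : ℤ) := by
    by_contra! hk
    have : (k : ℤ) = 0 := by omega
    rw [this] at c1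
    omega
  zify at hdeg hm1 hmS hSle hn3
  have hpq : 2 * q = p ^ 2 - p := by
    apply mul_left_cancel₀ hk.ne'
    rw [c1] at c2
    linear_combination -c2
  -- From kp = m + 2k, the bound m ≥ 1 gives p > 2, and 3m ≤ 3|S| ≤ kp gives p ≤ 3.
  have hp : p = 3 := by
    have h1 : 2 < p := by
      by_contra! h1
      nlinarith
    have h2 : p ≤ 3 := by
      by_contra! h2
      nlinarith
    omega
  subst hp
  have hq3 : q = 3 := by omega
  subst hq3
  refine ⟨⟨rfl, rfl⟩, S, ?_⟩
  have hSk : S.card = k := by omega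
  have hnk : n = 3 * k := by omega
  -- C(3k,3) exceeds the third coefficient of `(1 + 3X + 3X²) ^ k` by exactly k.
  have hbad : ((badTriples G).card : ℤ) = k := by
    have h6 := six_mul_cast_choose_three n
    rw [← c3', hnk] at h6
    push_cast at h6
    have : 6 * ((badTriples G).card : ℤ) = 6 * k := by linear_combination h6 - c3
    omega
  obtain ⟨H, T, e⟩ := exists_iso_attachPendants hG hS hblock (by omega) (by omega)
  exact ⟨H, T, Finset.card_pos.1 (by omega), e⟩

end Roots

/-! ### Attaching triples commutes with disjoint unions. -/

section Isomorphisms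

/-- Pull back along an equivalence of vertex sets. -/
def attachPendantsCongr {W W' : Type*} {H : SimpleGraph W} {H' : SimpleGraph W'} (e : H ≃g H')
    (T : Set W') : attachPendants H (e ⁻¹' T) ≃g attachPendants H' T where
  toEquiv := Equiv.prodCongr e.toEquiv (Equiv.refl _)
  map_rel_iff' := by
    rintro ⟨a, i⟩ ⟨b, j⟩
    simp [attachPendants, e.map_adj_iff]

def attachPendantsDisjointUnion {ι : Type*} {U : ι → Type*} (H : ∀ i, SimpleGraph (U i))
    (T : ∀ i, Set (U i)) :
    attachPendants (disjointUnion H) {x | x.2 ∈ T x.1} ≃g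
      disjointUnion fun i => attachPendants (H i) (T i) where
  toFun x := ⟨x.1.1, (x.1.2, x.2)⟩
  invFun x := (⟨x.1, x.2.1⟩, x.2.2)
  left_inv _ := rfl
  right_inv _ := rfl
  map_rel_iff' := by
    rintro ⟨⟨i, u⟩, a⟩ ⟨⟨j, v⟩, b⟩
    constructor
    · rintro ⟨l, ⟨x, a'⟩, ⟨y, b'⟩, hx, hy, h⟩
      cases hx
      cases hy
      rcases h with ⟨h1, h2, h3⟩ | ⟨h1, h2, h3⟩
      · exact Or.inl ⟨h1, h2, i, u, v, rfl, rfl, h3⟩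
      · obtain rfl : u = v := h1
        exact Or.inr ⟨rfl, h2, h3⟩
    · rintro (⟨h1, h2, l, x, y, hx, hy, h⟩ | ⟨h1, h2, h3⟩)
      · cases hx
        cases hy
        exact ⟨_, (_, a), (_, b), rfl, rfl, Or.inl ⟨h1, h2, h⟩⟩
      · cases h1
        exact ⟨i, (u, a), (u, b), rfl, rfl, Or.inr ⟨rfl, h2, h3⟩⟩

def disjointUnionCongr {ι : Type*} {U U' : ι → Type*} {H : ∀ i, SimpleGraph (U i)}
    {H' : ∀ i, SimpleGraph (U' i)} (e : ∀ i, H i ≃g H' i) :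
    disjointUnion H ≃g disjointUnion H' where
  toEquiv := Equiv.sigmaCongrRight fun i => (e i).toEquiv
  map_rel_iff' := by
    rintro ⟨i, u⟩ ⟨j, v⟩
    constructor
    · rintro ⟨l, x, y, hx, hy, h⟩
      cases hx
      cases hy
      exact ⟨i, u, v, rfl, rfl, (e i).map_adj_iff.1 h⟩
    · rintro ⟨l, x, y, hx, hy, h⟩
      cases hx
      cases hy
      exact ⟨_, _, _, rfl, rfl, (e _).map_adj_iff.2 h⟩

/-- A graph is the disjoint union of connected graphs on sets `Fin (n i)`. -/
theorem exists_iso_disjointUnion_connected {W : Type*} [Fintype W] (H : SimpleGraph W) :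
    ∃ (k : ℕ) (n : Fin k → ℕ) (K : ∀ i, SimpleGraph (Fin (n i))),
      (∀ i, (K i).Connected) ∧ Nonempty (disjointUnion K ≃g H) := by
  classical
  let f : Fin (Fintype.card H.ConnectedComponent) ≃ H.ConnectedComponent :=
    (Fintype.equivFin _).symm
  let g : ∀ i, (f i).supp ≃ Fin (Fintype.card (f i).supp) := fun i => Fintype.equivFin _
  refine ⟨_, fun i => Fintype.card (f i).supp,
    fun i => (H.induce (f i).supp).comap (g i).symm, fun i => ?_, ⟨?_⟩⟩
  · exact (SimpleGraph.Iso.comap (g i).symm _).connected_iff.2 (f i).connected_toSimpleGraph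
  · refine (disjointUnionCongr fun i => SimpleGraph.Iso.comap (g i).symm _).trans ?_
    refine ⟨Equiv.ofBijective (fun x : Σ i, (f i).supp => (x.2 : W)) ⟨?_, ?_⟩, ?_⟩
    · rintro ⟨i, u, hu⟩ ⟨j, v, hv⟩ huv
      obtain rfl : u = v := huv
      obtain rfl : i = j := f.injective (hu.symm.trans hv)
      rfl
    · intro w
      obtain ⟨i, hi⟩ := f.surjective (H.connectedComponentMk w)
      exact ⟨⟨i, w, hi.symm⟩, rfl⟩
    · rintro ⟨i, u, hu⟩ ⟨j, v, hv⟩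
      constructor
      · intro (h : H.Adj u v)
        obtain rfl : i = j := f.injective
          (hu.symm.trans ((SimpleGraph.ConnectedComponent.sound h.reachable).trans hv))
        exact ⟨i, ⟨u, hu⟩, ⟨v, hv⟩, rfl, rfl, h⟩
      · rintro ⟨l, x, y, hx, hy, h⟩
        cases hx
        cases hy
        exact h

/-- Several connected base graphs are equivalent to a single base graph that may be disconnected,
which is the form the counting argument produces. -/
theorem exists_disjointUnion_iff_exists_attachPendants {V : Type*} (G : SimpleGraph V) (r : ℕ) :
    (∃ (k : ℕ) (n : Fin k → ℕ) (F : ∀ i : Fin k, SimpleGraph (Fin (n i))),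
        1 ≤ k ∧ (∀ i : Fin k, InFamilyF (F i)) ∧
          Nonempty (G ≃g (disjointUnion F).sum (⊥ : SimpleGraph (Fin r)))) ↔
      ∃ (m : ℕ) (H : SimpleGraph (Fin m)) (T : Set (Fin m)),
        1 ≤ m ∧ Nonempty (G ≃g (attachPendants H T).sum (⊥ : SimpleGraph (Fin r))) := by
  classical
  constructor
  · rintro ⟨k, n, F, hk, hF, ⟨e⟩⟩
    choose m H T hH f using hF
    let g := Fintype.equivFin (Σ i, Fin (m i))
    let e' := SimpleGraph.Iso.comap g.symm (disjointUnion H)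
    refine ⟨_, _, e' ⁻¹' {x | x.2 ∈ T x.1}, ?_, ⟨e.trans (SimpleGraph.Iso.sumCongr
      ((disjointUnionCongr fun i => (f i).some).trans
        ((attachPendantsDisjointUnion H T).symm.trans (attachPendantsCongr e' _).symm)) .refl)⟩⟩
    have := (hH ⟨0, hk⟩).nonempty.some
    exact Fintype.card_pos_iff.2 ⟨⟨⟨0, hk⟩, this⟩⟩
  · rintro ⟨m, H, T, hm, ⟨e⟩⟩
    obtain ⟨k, n, K, hK, ⟨f⟩⟩ := exists_iso_disjointUnion_connected H
    let T' : ∀ i, Set (Fin (n i)) := fun i => {x | f ⟨i, x⟩ ∈ T}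
    let g : ∀ i, Fin (Fintype.card (Fin (n i) × Fin 3)) ≃ Fin (n i) × Fin 3 :=
      fun i => (Fintype.equivFin _).symm
    let e' := fun i => SimpleGraph.Iso.comap (g i) (attachPendants (K i) (T' i))
    refine ⟨k, _, fun i => (attachPendants (K i) (T' i)).comap (g i), ?_,
      fun i => ⟨n i, K i, T' i, hK i, ⟨e' i⟩⟩,
      ⟨e.trans (SimpleGraph.Iso.sumCongr ((attachPendantsCongr f T).symm.trans
        ((attachPendantsDisjointUnion K T').trans (disjointUnionCongr fun i => (e' i).symm)))
        .refl)⟩⟩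
    exact (f.symm ⟨0, hm⟩).1.pos

end Isomorphisms

/-! ### Graphs with exactly three roots. -/

section Main

variable {V : Type*} [Fintype V] [Nonempty V] {G : SimpleGraph V}

lemma mem_powerDomRoots {z : ℂ} : z ∈ powerDomRoots G ↔ aeval z (powerDomGenPoly G) = 0 := by
  rw [powerDomRoots, Set.mem_ofPred_eq, powerDomPoly_eq_genPoly]

lemma sq_add_three_mul_add_three_eq_zero_iff (z : ℂ) :
    z ^ 2 + 3 * z + 3 = 0 ↔ z = (-3 + (Real.sqrt 3 : ℂ) * Complex.I) / 2 ∨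
      z = (-3 - (Real.sqrt 3 : ℂ) * Complex.I) / 2 := by
  have h3 : (Real.sqrt 3 : ℂ) ^ 2 = 3 := by
    rw [← Complex.ofReal_pow, Real.sq_sqrt (by norm_num)]
    norm_num
  have e : z ^ 2 + 3 * z + 3 = (z - (-3 + (Real.sqrt 3 : ℂ) * Complex.I) / 2) *
      (z - (-3 - (Real.sqrt 3 : ℂ) * Complex.I) / 2) := by
    linear_combination (Complex.I ^ 2 / 4) * h3 + (3 / 4) * Complex.I_sq
  rw [e, mul_eq_zero, sub_eq_zero, sub_eq_zero]

lemma powerDomRoots_of_iso {m r : ℕ} {H : SimpleGraph (Fin m)} {T : Set (Fin m)} (hm : 1 ≤ m)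
    (e : G ≃g (attachPendants H T).sum (⊥ : SimpleGraph (Fin r))) :
    powerDomRoots G = {0, (-3 + (Real.sqrt 3 : ℂ) * Complex.I) / 2,
          (-3 - (Real.sqrt 3 : ℂ) * Complex.I) / 2} := by
  ext z
  have h3 : z ^ 3 + 3 * z ^ 2 + 3 * z = z * (z ^ 2 + 3 * z + 3) := by ring
  rw [mem_powerDomRoots, powerDomGenPoly_congr e, powerDomGenPoly_sum,
    powerDomGenPoly_attachPendants, powerDomGenPoly_bot, Set.mem_insert_iff, Set.mem_insert_iff,
    Set.mem_singleton_iff, ← sq_add_three_mul_add_three_eq_zero_iff]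
  have h4 : aeval z (3 : ℤ[X]) = 3 := map_ofNat _ 3
  simp [h3, h4, show m ≠ 0 by omega]
  tauto

lemma ncard_three_roots : ({0, (-3 + (Real.sqrt 3 : ℂ) * Complex.I) / 2,
          (-3 - (Real.sqrt 3 : ℂ) * Complex.I) / 2} : Set ℂ).ncard = 3 := by
  rw [Set.ncard_eq_three]
  refine ⟨_, _, _, ?_, ?_, ?_, rfl⟩
  · intro h
    have := congrArg Complex.re h
    norm_num at this
  · intro h
    have := congrArg Complex.re h
    norm_num at this
  · intro h
    have h2 := congrArg Complex.im h
    have h3 : 0 < Real.sqrt 3 := by positivity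
    simp at h2
    linarith

/-- Besides 0 there are only two roots, so the conjugates of a nonintegral root `α` of `K` are
exactly these two, which leaves no room for -2. -/
theorem exists_iso_of_ncard_powerDomRoots (h : (powerDomRoots G).ncard = 3) :
    ∃ (m r : ℕ) (H : SimpleGraph (Fin m)) (T : Set (Fin m)),
      1 ≤ m ∧ Nonempty (G ≃g (attachPendants H T).sum (⊥ : SimpleGraph (Fin r))) := by
  classical
  have hfin : (powerDomRoots G).Finite := Set.finite_of_ncard_ne_zero (by omega)
  obtain ⟨U, _, K, a, b, hK, hQ, hI⟩ := exists_noSmallComponent_part G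
  have hmem : ∀ z, z ∈ powerDomRoots G ↔
      (z = 0 ∧ a ≠ 0) ∨ (z + 2 = 0 ∧ b ≠ 0) ∨ aeval z (powerDomGenPoly K) = 0 := by
    intro z
    rw [mem_powerDomRoots, hQ]
    have h2 : aeval z (2 : ℤ[X]) = 2 := map_ofNat _ 2
    simp [or_assoc, h2]
  -- If nothing remained after stripping, only 0 and -2 could be roots.
  have hU : Nonempty U := by
    by_contra hU
    rw [not_nonempty_iff] at hU
    have hsub : powerDomRoots G ⊆ {0, -2} := by
      intro z hz
      rw [hmem, Subsingleton.elim K ⊥, powerDomGenPoly_bot, Fintype.card_eq_zero] at hz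
      rcases hz with hz | hz | hz
      · exact Or.inl hz.1
      · exact Or.inr (eq_neg_of_add_eq_zero_left hz.1)
      · simp at hz
    have := (Set.ncard_le_ncard hsub).trans (Set.ncard_insert_le _ _)
    rw [Set.ncard_singleton] at this
    omega
  obtain ⟨α, hα0, hαZ⟩ := hK.exists_root_not_int
  have hα : IsIntegral ℤ α := ⟨_, monic_powerDomGenPoly, by rwa [aeval_def] at hα0⟩
  have hne := aeval_intCast_minpoly_ne_zero hα hαZ
  have h0 : (0 : ℂ) ∈ powerDomRoots G := (hmem 0).2 (.inr (.inr aeval_zero_powerDomGenPoly))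
  set R := {z : ℂ | aeval z (minpoly ℤ α) = 0} with hR
  have hsub : R ⊆ powerDomRoots G \ {0} := by
    intro z hz
    refine ⟨(hmem z).2 (.inr (.inr ?_)), ?_⟩
    · obtain ⟨P, hP⟩ := minpoly.isIntegrallyClosed_dvd hα hα0
      rw [hP, map_mul, show aeval z (minpoly ℤ α) = 0 from hz, zero_mul]
    · rintro rfl
      exact hne 0 (by rw [Int.cast_zero]; exact hz)
  have hcard : (powerDomRoots G \ {0}).ncard = 2 := by
    rw [Set.ncard_sdiff_singleton_of_mem h0, h]
  have hRcard : R.ncard = (minpoly ℤ α).natDegree := ncard_roots_minpoly hα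
  have hdeg1 : (minpoly ℤ α).natDegree ≠ 1 := fun h1 => hαZ (minpoly.natDegree_eq_one_iff.1 h1)
  have hdeg0 := minpoly.natDegree_pos hα
  have hle := Set.ncard_le_ncard hsub hfin.sdiff
  have hdeg : (minpoly ℤ α).natDegree = 2 := by omega
  have hReq : R = powerDomRoots G \ {0} :=
    Set.eq_of_subset_of_ncard_le hsub (by omega) hfin.sdiff
  have hb : b = 0 := by
    by_contra hb
    have h2 : (-2 : ℂ) ∈ R := by
      rw [hReq]
      exact ⟨(hmem _).2 (.inr (.inl ⟨by norm_num, hb⟩)), by norm_num⟩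
    exact hne (-2) (by push_cast; exact h2)
  obtain ⟨m, k, hmk⟩ := eq_X_pow_mul_minpoly_pow hα (powerDomGenPoly K) monic_powerDomGenPoly
    fun z hz => by
      by_cases hz0 : z = 0
      · exact .inl hz0
      · refine .inr ?_
        have : z ∈ R := by
          rw [hReq]
          exact ⟨(hmem z).2 (.inr (.inr hz)), hz0⟩
        exact this
  have hpoly : minpoly ℤ α =
      X ^ 2 + C ((minpoly ℤ α).coeff 1) * X + C ((minpoly ℤ α).coeff 0) := by
    have h2 := (minpoly.monic hα).as_sum
    rw [hdeg, Finset.sum_range_succ, Finset.sum_range_one] at h2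
    conv_lhs => rw [h2]
    ring
  have hq : (minpoly ℤ α).coeff 0 ≠ 0 := by
    intro hq
    exact hne 0 (by simp [aeval_def, eval₂_at_zero, hq])
  rw [hpoly] at hmk
  obtain ⟨-, S, H, T, hS, ⟨e⟩⟩ := hK.exists_iso_of_eq_mul_pow hq hmk
  obtain ⟨f⟩ := hI hb
  let g := SimpleGraph.Iso.comap S.equivFin.symm H
  exact ⟨_, a, _, g ⁻¹' T, Finset.card_pos.2 hS, ⟨f.trans (SimpleGraph.Iso.sumCongr
    (e.trans (attachPendantsCongr g T).symm) .refl)⟩⟩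

end Main

theorem mainTheorem1 {V : Type*} [Fintype V] [Nonempty V] (G : SimpleGraph V) :
    ((powerDomRoots G).ncard = 3 ↔
      ∃ (k r : ℕ) (n : Fin k → ℕ) (F : ∀ i : Fin k, SimpleGraph (Fin (n i))),
        1 ≤ k ∧ (∀ i : Fin k, InFamilyF (F i)) ∧
          Nonempty (G ≃g (disjointUnion F).sum (⊥ : SimpleGraph (Fin r)))) ∧
    ((powerDomRoots G).ncard = 3 →
      powerDomRoots G =
        {0, (-3 + (Real.sqrt 3 : ℂ) * Complex.I) / 2,
          (-3 - (Real.sqrt 3 : ℂ) * Complex.I) / 2}) := by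
  refine ⟨⟨fun h => ?_, ?_⟩, fun h => ?_⟩
  · obtain ⟨m, r, H, T, hm, he⟩ := exists_iso_of_ncard_powerDomRoots h
    obtain ⟨k, n, F, hF⟩ :=
      (exists_disjointUnion_iff_exists_attachPendants G r).2 ⟨m, H, T, hm, he⟩
    exact ⟨k, r, n, F, hF⟩
  · rintro ⟨k, r, n, F, hF⟩
    obtain ⟨m, H, T, hm, ⟨e⟩⟩ :=
      (exists_disjointUnion_iff_exists_attachPendants G r).1 ⟨k, n, F, hF⟩
    rw [powerDomRoots_of_iso hm e, ncard_three_roots]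
  · obtain ⟨m, r, H, T, hm, ⟨e⟩⟩ := exists_iso_of_ncard_powerDomRoots h
    exact powerDomRoots_of_iso hm e
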